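/- For a topological space $Y$, an abelian group $G$ and $n\ge 0$, let $H^n(Y;G)$ denote Alexander–Spanier cohomology: the $n$-th cohomology of the complex of all functions $\varphi:Y^{n+1}\to G$ modulo the locally zero ones (those $\varphi$ for which every point of $Y$ has a neighbourhood $U$ with $\varphi=0$ on $U^{n+1}$), with the coboundary $(\delta\varphi)(y_0,\dots,y_{n+1})=\sum_{i=0}^{n+1}(-1)^i\varphi(y_0,\dots,\widehat{y_i},\dots,y_{n+1})$. For paracompact Hausdorff spaces this agrees with Čech cohomology. **Theorem.** Let $p$ be a prime and let $\mathbb Z_p$ be the field with $p$ elements. There exist locally compact connected Hausdorff spaces $X$ and $T$ and points $r,s\in T$ such that the embeddings $F_r,F_s:X\to X\times T$, $F_r(x)=(x,r)$ and $F_s(x)=(x,s)$, induce different homomorphisms $H^n(X\times T;\mathbb Z_p)\to H^n(X;\mathbb Z_p)$ for some $n$. Explicitly, one may take $n=1$ and, with the subspace topology of the plane, $$X=T=\{(x,y)\in\mathbb R^2 : 0<x\le 1,\ y=\sin(1/x)\}\ \cup\ \{(0,y) : -1\le y<0\},\qquad r=(0,-1),\quad s=(1,\sin 1):$$ the space $T$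 is locally compact and connected, and $F_r^*\ne F_s^*: H^1(T\times T;\mathbb Z_p)\to H^1(T;\mathbb Z_p)$. -/

import Mathlib

open scoped Topology

namespace AlexanderSpanier

universe u v w

section Complex

variable (X : Type u) [TopologicalSpace X] (G : Type w) [AddCommGroup G]

/-- All functions from `(n+1)`-tuples of points of `X` to `G`, with no continuity required. -/
abbrev Cochain (X : Type u) (G : Type w) (n : ℕ) : Type (max u w) := (Fin (n + 1) → X) → G

/-- The coboundary `(δφ)(x₀,…,x_{n+1}) = ∑ᵢ (-1)ⁱ φ(x₀,…,x̂ᵢ,…,x_{n+1})`. -/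
def delta (X : Type u) (G : Type w) [AddCommGroup G] (n : ℕ) :
    Cochain X G n →+ Cochain X G (n + 1) where
  toFun φ := fun x => ∑ i : Fin (n + 2), (-1 : ℤ) ^ (i : ℕ) • φ (fun j => x (i.succAbove j))
  map_zero' := by
    funext x
    simp
  map_add' φ ψ := by
    funext x
    simp [Finset.sum_add_distrib]

/-- The locally zero cochains: those for which every point has a neighbourhood `U` such that the
cochain vanishes on all tuples of points of `U` (equivalently, there is an open cover such that
the cochain vanishes on all tuples lying in one member of the cover). -/
def locallyZero (n : ℕ) : AddSubgroup (Cochain X G n) where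
  carrier := {φ | ∀ a : X, ∃ U ∈ 𝓝 a, ∀ x : Fin (n + 1) → X, (∀ i, x i ∈ U) → φ x = 0}
  zero_mem' := fun _ => ⟨Set.univ, Filter.univ_mem, fun _ _ => rfl⟩
  add_mem' := by
    intro φ ψ hφ hψ a
    obtain ⟨U, hU, hU0⟩ := hφ a
    obtain ⟨V, hV, hV0⟩ := hψ a
    refine ⟨U ∩ V, Filter.inter_mem hU hV, fun x hx => ?_⟩
    rw [Pi.add_apply, hU0 x (fun i => (hx i).1), hV0 x (fun i => (hx i).2), add_zero]
  neg_mem' := by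
    intro φ hφ a
    obtain ⟨U, hU, hU0⟩ := hφ a
    refine ⟨U, hU, fun x hx => ?_⟩
    rw [Pi.neg_apply, hU0 x hx, neg_zero]

theorem delta_mem_locallyZero (n : ℕ) :
    locallyZero X G n ≤ (locallyZero X G (n + 1)).comap (delta X G n) := by
  intro φ hφ a
  obtain ⟨U, hU, hU0⟩ := hφ a
  refine ⟨U, hU, fun x hx => ?_⟩
  change ∑ i : Fin (n + 2), (-1 : ℤ) ^ (i : ℕ) • φ (fun j => x (i.succAbove j)) = 0
  refine Finset.sum_eq_zero fun i _ => ?_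
  rw [hU0 _ (fun j => hx (i.succAbove j)), smul_zero]

/-- The Alexander–Spanier cochains: all cochains modulo the locally zero ones. -/
abbrev QuotCochain (n : ℕ) : Type (max u w) := Cochain X G n ⧸ locallyZero X G n

/-- The coboundary on the Alexander–Spanier cochain complex. -/
def dbar (n : ℕ) : QuotCochain X G n →+ QuotCochain X G (n + 1) :=
  QuotientAddGroup.map (locallyZero X G n) (locallyZero X G (n + 1)) (delta X G n)
    (delta_mem_locallyZero X G n)

/-- The cocycles of degree `n`. -/
def cocycles (n : ℕ) : AddSubgroup (QuotCochain X G n) := (dbar X G n).ker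

/-- The coboundaries of degree `n`; only zero is a coboundary in degree `0`. -/
def coboundaries : (n : ℕ) → AddSubgroup (QuotCochain X G n)
  | 0 => ⊥
  | n + 1 => (dbar X G n).range

/-- Alexander–Spanier cohomology `Hⁿ(X; G)`: cocycles modulo coboundaries. -/
abbrev H (n : ℕ) : Type (max u w) :=
  cocycles X G n ⧸ (coboundaries X G n).addSubgroupOf (cocycles X G n)

end Complex

section Functoriality

variable {X : Type u} [TopologicalSpace X] {Y : Type v} [TopologicalSpace Y]
  (G : Type w) [AddCommGroup G] (f : C(X, Y))

/-- Pull-back of cochains: `(f^# φ)(x₀,…,xₙ) = φ(f x₀,…,f xₙ)`. -/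
def pullback (n : ℕ) : Cochain Y G n →+ Cochain X G n where
  toFun φ := fun x => φ (fun i => f (x i))
  map_zero' := rfl
  map_add' _ _ := rfl

theorem pullback_mem_locallyZero (n : ℕ) :
    locallyZero Y G n ≤ (locallyZero X G n).comap (pullback G f n) := by
  intro φ hφ a
  obtain ⟨U, hU, hU0⟩ := hφ (f a)
  exact ⟨f ⁻¹' U, f.continuous.continuousAt hU, fun x hx => hU0 _ hx⟩

/-- Pull-back of Alexander–Spanier cochains. -/
def quotPullback (n : ℕ) : QuotCochain Y G n →+ QuotCochain X G n :=
  QuotientAddGroup.map (locallyZero Y G n) (locallyZero X G n) (pullback G f n)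
    (pullback_mem_locallyZero G f n)

theorem dbar_quotPullback (n : ℕ) (c : QuotCochain Y G n) :
    dbar X G n (quotPullback G f n c) = quotPullback G f (n + 1) (dbar Y G n c) := by
  induction c using QuotientAddGroup.induction_on with
  | H φ => rfl

theorem quotPullback_mem_cocycles (n : ℕ) (c : cocycles Y G n) :
    quotPullback G f n c ∈ cocycles X G n := by
  have hc : dbar Y G n c = 0 := c.2
  change dbar X G n (quotPullback G f n c) = 0
  rw [dbar_quotPullback, hc, map_zero]

theorem quotPullback_mem_coboundaries (n : ℕ) (c : QuotCochain Y G n)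
    (hc : c ∈ coboundaries Y G n) : quotPullback G f n c ∈ coboundaries X G n := by
  cases n with
  | zero =>
    have hc0 : c = 0 := hc
    rw [hc0, map_zero]
    exact zero_mem _
  | succ n =>
    obtain ⟨b, rfl⟩ := hc
    exact ⟨quotPullback G f n b, dbar_quotPullback G f n b⟩

/-- Pull-back of cocycles. -/
def cocyclesMap (n : ℕ) : cocycles Y G n →+ cocycles X G n :=
  ((quotPullback G f n).comp (cocycles Y G n).subtype).codRestrict (cocycles X G n)
    (quotPullback_mem_cocycles G f n)

/-- The homomorphism `f* : Hⁿ(Y; G) → Hⁿ(X; G)` induced by a continuous map `f : X → Y`. -/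
def H.map (n : ℕ) : H Y G n →+ H X G n :=
  QuotientAddGroup.map _ _ (cocyclesMap G f n)
    (fun c hc => quotPullback_mem_coboundaries G f n c hc)

end Functoriality

end AlexanderSpanier

/-- The slice embedding `F_t : X → X × T`, `x ↦ (x, t)`. -/
def sliceEmbedding (X : Type*) {T : Type*} [TopologicalSpace X] [TopologicalSpace T] (t : T) :
    C(X, X × T) :=
  (ContinuousMap.id X).prodMk (ContinuousMap.const X t)

/-- The modified topologist's sine curve: the graph of `sin (1/x)` over `0 < x ≤ 1` together with
the half-open segment `{0} × [-1, 0)`, with the subspace topology of the plane. -/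
def modifiedSineCurve : Set (ℝ × ℝ) :=
  {q | (0 < q.1 ∧ q.1 ≤ 1 ∧ q.2 = Real.sin (1 / q.1)) ∨ (q.1 = 0 ∧ -1 ≤ q.2 ∧ q.2 < 0)}

/-- The point `(0, -1)` of the modified sine curve. -/
def rPoint : modifiedSineCurve :=
  ⟨(0, -1), Or.inr ⟨rfl, le_refl _, by norm_num⟩⟩

/-- The point `(1, sin 1)` of the modified sine curve. -/
noncomputable def sPoint : modifiedSineCurve :=
  ⟨(1, Real.sin 1), Or.inl ⟨one_pos, le_refl _, by norm_num⟩⟩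

/-! A function `h : X → [0, ∞]` whose finite values near each pole `h = ∞` are integers yields a
continuous map from `X` to the circle `ℝ / ℤ`, hence a class in `H¹(X; G)` for each `g : G`. The
sine curve carries such a height with poles on the limit segment: it climbs by one over every
positive arch of `sin (1 / x)` and is constant, an integer, over every negative one; near the
segment the ordinate is negative.

The minimum `min (h x) (h t)` is such a function on `T × T`. On the slice through `s`, where `h` is
minimal, it is constant, so its class restricts to zero. On the slice through `r`, where `h = ∞`, it
is `h` itself. A primitive of that class would be constant along the connected graph, whereas `h`
changes by one between two consecutive visits of the graph to a small neighbourhood of `r`.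
-/

namespace AlexanderSpanier

section Cohomology

variable {Y G : Type*} [AddCommGroup G] {n : ℕ}

theorem delta_zero_apply (ψ : Cochain Y G 0) (y : Fin 2 → Y) :
    delta Y G 0 ψ y = ψ ![y 1] - ψ ![y 0] := by
  have h0 : (fun j : Fin 1 => y ((0 : Fin 2).succAbove j)) = ![y 1] := by
    funext j; fin_cases j; rfl
  have h1 : (fun j : Fin 1 => y ((1 : Fin 2).succAbove j)) = ![y 0] := by
    funext j; fin_cases j; rfl
  change ∑ i : Fin 2, (-1 : ℤ) ^ (i : ℕ) • ψ (fun j => y (i.succAbove j)) = _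
  rw [Fin.sum_univ_two, h0, h1]
  simp [sub_eq_add_neg]

theorem delta_one_apply (φ : Cochain Y G 1) (y : Fin 3 → Y) :
    delta Y G 1 φ y = φ ![y 1, y 2] - φ ![y 0, y 2] + φ ![y 0, y 1] := by
  have h0 : (fun j : Fin 2 => y ((0 : Fin 3).succAbove j)) = ![y 1, y 2] := by
    funext j; fin_cases j <;> rfl
  have h1 : (fun j : Fin 2 => y ((1 : Fin 3).succAbove j)) = ![y 0, y 2] := by
    funext j; fin_cases j <;> rfl
  have h2 : (fun j : Fin 2 => y ((2 : Fin 3).succAbove j)) = ![y 0, y 1] := by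
    funext j; fin_cases j <;> rfl
  change ∑ i : Fin 3, (-1 : ℤ) ^ (i : ℕ) • φ (fun j => y (i.succAbove j)) = _
  rw [Fin.sum_univ_three, h0, h1, h2]
  simp [sub_eq_add_neg]

variable [TopologicalSpace Y]

/-- The Alexander–Spanier cohomology class represented by a cochain whose coboundary is locally
zero. -/
def cohomologyClass (φ : Cochain Y G n) (hφ : delta Y G n φ ∈ locallyZero Y G (n + 1)) : H Y G n :=
  QuotientAddGroup.mk ⟨QuotientAddGroup.mk φ, (QuotientAddGroup.eq_zero_iff _).2 hφ⟩

theorem cohomologyClass_eq_zero_iff {φ : Cochain Y G (n + 1)}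
    {hφ : delta Y G (n + 1) φ ∈ locallyZero Y G (n + 2)} :
    cohomologyClass φ hφ = 0 ↔ ∃ ψ : Cochain Y G n, delta Y G n ψ - φ ∈ locallyZero Y G (n + 1) :=
  calc cohomologyClass φ hφ = 0
    _ ↔ (QuotientAddGroup.mk φ : QuotCochain Y G (n + 1)) ∈ (dbar Y G n).range :=
      QuotientAddGroup.eq_zero_iff (N := (coboundaries Y G (n + 1)).addSubgroupOf _) _
    _ ↔ ∃ ψ : Cochain Y G n, delta Y G n ψ - φ ∈ locallyZero Y G (n + 1) :=
      (QuotientAddGroup.mk_surjective.exists).trans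
        (exists_congr fun _ => QuotientAddGroup.eq_iff_sub_mem)

end Cohomology

section WindingClass

open Filter

variable {X Y G : Type*} [TopologicalSpace X] [TopologicalSpace Y] [AddCommGroup G]

theorem round_sub_of_norm_lt {x y : ℝ} (hx : ‖(x : UnitAddCircle)‖ < 1 / 4)
    (hy : ‖(y : UnitAddCircle)‖ < 1 / 4) : round (y - x) = round y - round x := by
  rw [UnitAddCircle.norm_eq, abs_lt] at hx hy
  rw [round_eq_iff, Set.mem_Ico]
  push_cast
  constructor <;> linarith

/-- The `1`-cochain `(y₀, y₁) ↦ n • g`, where `n` is the integer nearest to `l y₁ - l y₀`. When `l`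
is continuous modulo `ℤ` it represents the pullback along `l : Y → ℝ / ℤ` of `g` times the
fundamental class of the circle. -/
noncomputable def windingCochain (g : G) (l : Y → ℝ) : Cochain Y G 1 :=
  fun y => round (l (y 1) - l (y 0)) • g

theorem delta_windingCochain_mem_locallyZero (g : G) {l : Y → ℝ}
    (hl : Continuous fun y => (l y : UnitAddCircle)) :
    delta Y G 1 (windingCochain g l) ∈ locallyZero Y G 2 := by
  intro a
  have hnear : ∀ᶠ b in 𝓝 a, ‖((l b - l a : ℝ) : UnitAddCircle)‖ < 1 / 4 := by
    simpa only [dist_eq_norm, AddCircle.coe_sub] using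
      Metric.continuousAt_iff'.1 hl.continuousAt (1 / 4) (by norm_num)
  refine ⟨_, hnear, fun y hy => ?_⟩
  have hround (i j : Fin 3) :
      round (l (y j) - l (y i)) = round (l (y j) - l a) - round (l (y i) - l a) := by
    rw [← round_sub_of_norm_lt (hy i) (hy j), sub_sub_sub_cancel_right]
  rw [delta_one_apply]
  change round (l (y 2) - l (y 1)) • g - round (l (y 2) - l (y 0)) • g
    + round (l (y 1) - l (y 0)) • g = 0
  simp only [hround, sub_smul]
  abel

/-- The class in `H¹(Y; G)` pulled back from `g` times the fundamental class of the circle `ℝ / ℤ`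
along a map `Y → ℝ / ℤ`. The map is given by a lift `l` to `ℝ` that need not be continuous. -/
noncomputable def windingClass (g : G) (l : Y → ℝ)
    (hl : Continuous fun y => (l y : UnitAddCircle)) : H Y G 1 :=
  cohomologyClass (windingCochain g l) (delta_windingCochain_mem_locallyZero g hl)

theorem map_windingClass (g : G) {l : Y → ℝ} (hl : Continuous fun y => (l y : UnitAddCircle))
    (f : C(X, Y)) :
    H.map G f 1 (windingClass g l hl) = windingClass g (l ∘ f) (hl.comp f.continuous) :=
  rfl

theorem windingClass_eq_zero_iff {g : G} {l : Y → ℝ}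
    {hl : Continuous fun y => (l y : UnitAddCircle)} :
    windingClass g l hl = 0 ↔ ∃ ψ : Y → G, ∀ a, ∃ U ∈ 𝓝 a, ∀ b ∈ U, ∀ c ∈ U,
      ψ c - ψ b = round (l c - l b) • g := by
  refine cohomologyClass_eq_zero_iff.trans ⟨?_, ?_⟩
  · rintro ⟨ψ, hψ⟩
    refine ⟨fun y => ψ ![y], fun a => ?_⟩
    obtain ⟨U, hU, h⟩ := hψ a
    refine ⟨U, hU, fun b hb c hc => sub_eq_zero.1 ?_⟩
    have hbc := h ![b, c] (by simp [Fin.forall_fin_two, hb, hc])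
    rwa [Pi.sub_apply, delta_zero_apply] at hbc
  · rintro ⟨ψ, hψ⟩
    refine ⟨fun y => ψ (y 0), fun a => ?_⟩
    obtain ⟨U, hU, h⟩ := hψ a
    refine ⟨U, hU, fun y hy => ?_⟩
    rw [Pi.sub_apply, delta_zero_apply]
    exact sub_eq_zero.2 (h _ (hy 0) _ (hy 1))

theorem windingClass_eq_zero_of_forall_eq (g : G) {l : Y → ℝ}
    (hl : Continuous fun y => (l y : UnitAddCircle)) (h : ∀ a b, l a = l b) :
    windingClass g l hl = 0 :=
  windingClass_eq_zero_iff.2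
    ⟨0, fun _ => ⟨Set.univ, univ_mem, fun b _ c _ => by simp [h c b]⟩⟩

theorem isLocallyConstant_of_sub_eq_round_smul {I : Type*} [TopologicalSpace I] {g : G}
    {l : Y → ℝ} {ψ : Y → G} {γ : I → Y}
    (hψ : ∀ a, ∃ U ∈ 𝓝 a, ∀ b ∈ U, ∀ c ∈ U, ψ c - ψ b = round (l c - l b) • g)
    (hγ : Continuous γ) (hlγ : Continuous (l ∘ γ)) : IsLocallyConstant (ψ ∘ γ) := by
  refine (IsLocallyConstant.iff_eventually_eq _).2 fun t => ?_
  obtain ⟨U, hU, h⟩ := hψ (γ t)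
  filter_upwards [hγ.continuousAt hU,
    Metric.continuousAt_iff'.1 hlγ.continuousAt (1 / 2) (by norm_num)] with u huU hu
  have hround : round (l (γ u) - l (γ t)) = 0 := by
    rw [Real.dist_eq, Function.comp_apply, Function.comp_apply, abs_lt] at hu
    exact round_eq_zero_iff.2 ⟨hu.1.le, hu.2⟩
  simpa [hround, sub_eq_zero] using h _ (mem_of_mem_nhds hU) _ huU

theorem windingClass_ne_zero_of_returns {I : Type*} [TopologicalSpace I] [PreconnectedSpace I]
    {g : G} {l : Y → ℝ} (hl : Continuous fun y => (l y : UnitAddCircle)) {γ : I → Y}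
    (hγ : Continuous γ) (hlγ : Continuous (l ∘ γ)) {a : Y}
    (ha : ∀ U ∈ 𝓝 a, ∃ t u, γ t ∈ U ∧ γ u ∈ U ∧ round (l (γ u) - l (γ t)) • g ≠ 0) :
    windingClass g l hl ≠ 0 := fun h0 => by
  obtain ⟨ψ, hψ⟩ := windingClass_eq_zero_iff.1 h0
  obtain ⟨U, hU, h⟩ := hψ a
  obtain ⟨t, u, ht, hu, hne⟩ := ha U hU
  have hconst : ψ (γ u) = ψ (γ t) :=
    (isLocallyConstant_of_sub_eq_round_smul hψ hγ hlγ).apply_eq_of_preconnectedSpace u t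
  exact hne (by rw [← h _ ht _ hu, hconst, sub_self])

end WindingClass

section Height

open Filter
open scoped ENNReal

variable {X T : Type*} [TopologicalSpace X] [TopologicalSpace T]

/-- A height on `X`: a continuous function to `[0, ∞]` whose finite values near each of its poles
are integers. Integrality is imposed on `(h y).toReal`, so that it holds trivially at a pole, where
`ENNReal.toReal` takes the junk value `0`. -/
structure IsHeight (h : X → ℝ≥0∞) : Prop where
  continuous : Continuous h
  eventually_coe_eq_zero : ∀ x, h x = ∞ → ∀ᶠ y in 𝓝 x, ((h y).toReal : UnitAddCircle) = 0

namespace IsHeight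

theorem comp {h : X → ℝ≥0∞} (hh : IsHeight h) {f : T → X} (hf : Continuous f) :
    IsHeight (h ∘ f) where
  continuous := hh.continuous.comp hf
  eventually_coe_eq_zero x hx := hf.continuousAt.eventually (hh.eventually_coe_eq_zero (f x) hx)

protected theorem min {h k : X → ℝ≥0∞} (hh : IsHeight h) (hk : IsHeight k) :
    IsHeight fun x => min (h x) (k x) where
  continuous := hh.continuous.min hk.continuous
  eventually_coe_eq_zero x hx := by
    obtain ⟨hx, kx⟩ := min_eq_top.1 hx
    filter_upwards [hh.eventually_coe_eq_zero x hx, hk.eventually_coe_eq_zero x kx] with y hy ky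
    rcases min_choice (h y) (k y) with h_eq | k_eq
    · rwa [h_eq]
    · rwa [k_eq]

theorem continuous_coe_toReal {h : X → ℝ≥0∞} (hh : IsHeight h) :
    Continuous fun x => ((h x).toReal : UnitAddCircle) := by
  refine continuous_iff_continuousAt.2 fun x => ?_
  by_cases hx : h x = ∞
  · have hzero := hh.eventually_coe_eq_zero x hx
    exact continuousAt_const.congr (hzero.mono fun _ => Eq.symm)
  · exact (AddCircle.continuous_mk' 1).continuousAt.comp
      ((ENNReal.tendsto_toReal hx).comp hh.continuous.continuousAt)

theorem map_sliceEmbedding_ne {G : Type*} [AddCommGroup G] {g : G} {h : X → ℝ≥0∞} {k : T → ℝ≥0∞}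
    (hh : IsHeight h) (hk : IsHeight k)
    (hg : windingClass g (fun x => (h x).toReal) hh.continuous_coe_toReal ≠ 0)
    {r s : T} (hr : k r = ∞) (hs : ∀ x, k s ≤ h x) :
    H.map G (sliceEmbedding X r) 1 ≠ H.map G (sliceEmbedding X s) 1 := by
  have hmin := (hh.comp continuous_fst).min (hk.comp continuous_snd)
  let c := windingClass g _ hmin.continuous_coe_toReal
  have hrc : H.map G (sliceEmbedding X r) 1 c ≠ 0 := by
    rw [map_windingClass]
    convert hg using 3 with x
    change (min (h x) (k r)).toReal = (h x).toReal
    rw [hr, min_top_right]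
  have hsc : H.map G (sliceEmbedding X s) 1 c = 0 := by
    rw [map_windingClass]
    refine windingClass_eq_zero_of_forall_eq _ _ fun x y => ?_
    change (min (h x) (k s)).toReal = (min (h y) (k s)).toReal
    rw [min_eq_right (hs x), min_eq_right (hs y)]
  exact fun heq => hrc (by rw [heq, hsc])

end IsHeight

end Height

end AlexanderSpanier

/-- The continuous staircase `v ↦ v + dist(v, ℤ)`: over each `[n, n + 1]` with `n` an integer it
climbs from `n` to `n + 1` on the left half and is constant on the right half. -/
noncomputable def staircase (v : ℝ) : ℝ := v + ‖(v : UnitAddCircle)‖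

theorem continuous_staircase : Continuous staircase :=
  continuous_id.add (AddCircle.continuous_mk' 1).norm

theorem le_staircase (v : ℝ) : v ≤ staircase v :=
  le_add_of_nonneg_right (norm_nonneg _)

theorem monotone_staircase : Monotone staircase := fun v w hvw => by
  have hnorm : ‖(v : UnitAddCircle)‖ - ‖(w : UnitAddCircle)‖ ≤ w - v :=
    calc ‖(v : UnitAddCircle)‖ - ‖(w : UnitAddCircle)‖
      _ ≤ ‖((v - w : ℝ) : UnitAddCircle)‖ := norm_sub_norm_le _ _
      _ ≤ |v - w| := QuotientAddGroup.norm_mk_le_norm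
      _ = w - v := by rw [abs_sub_comm, abs_of_nonneg (sub_nonneg.2 hvw)]
  rw [staircase, staircase]
  linarith

theorem staircase_add_one (v : ℝ) : staircase (v + 1) = staircase v + 1 := by
  rw [staircase, staircase, AddCircle.coe_add_period]
  ring

theorem staircase_eq_round {v : ℝ} (h : v ≤ round v) : staircase v = round v := by
  rw [staircase, UnitAddCircle.norm_eq, abs_sub_comm, abs_of_nonneg (sub_nonneg.2 h),
    add_sub_cancel]

theorem le_round_of_sin_neg {v : ℝ} (h : Real.sin (v * (2 * Real.pi)) < 0) : v ≤ round v := by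
  by_contra! hlt
  have hhalf : v - round v ≤ 1 / 2 := (le_abs_self _).trans (abs_sub_round v)
  have hsin : Real.sin (v * (2 * Real.pi)) = Real.sin ((v - round v) * (2 * Real.pi)) := by
    rw [sub_mul, Real.sin_sub_int_mul_two_pi]
  refine h.not_ge (hsin ▸ Real.sin_nonneg_of_nonneg_of_le_pi ?_ ?_)
  · exact mul_nonneg (sub_nonneg.2 hlt.le) Real.two_pi_pos.le
  · nlinarith [Real.pi_pos]

namespace modifiedSineCurve

open Filter
open scoped ENNReal

theorem fst_nonneg (a : modifiedSineCurve) : 0 ≤ a.1.1 := by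
  rcases a.2 with ⟨h0, -, -⟩ | ⟨h0, -, -⟩
  · exact h0.le
  · exact h0.ge

theorem fst_le_one (a : modifiedSineCurve) : a.1.1 ≤ 1 := by
  rcases a.2 with ⟨-, h1, -⟩ | ⟨h0, -, -⟩
  · exact h1
  · exact h0.trans_le zero_le_one

theorem snd_eq_sin {a : modifiedSineCurve} (h : a.1.1 ≠ 0) : a.1.2 = Real.sin (1 / a.1.1) := by
  rcases a.2 with ⟨-, -, hsin⟩ | ⟨h0, -, -⟩
  · exact hsin
  · exact absurd h0 h

theorem snd_mem_Ico {a : modifiedSineCurve} (h : a.1.1 = 0) : a.1.2 ∈ Set.Ico (-1 : ℝ) 0 := by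
  rcases a.2 with ⟨h0, -, -⟩ | ⟨-, hmem⟩
  · exact absurd h h0.ne'
  · exact hmem

theorem continuous_abscissa : Continuous fun a : modifiedSineCurve => a.1.1 := by fun_prop

section Topology

/-- The parametrization `u ↦ (1 / u, sin u)` of the graph part of the curve. -/
noncomputable def graphPoint (u : Set.Ici (1 : ℝ)) : modifiedSineCurve :=
  ⟨(1 / u, Real.sin u), by
    have hu : (1 : ℝ) ≤ u := u.2
    exact Or.inl ⟨by positivity, div_le_self zero_le_one hu, by rw [one_div_one_div]⟩⟩

theorem continuous_graphPoint : Continuous graphPoint := by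
  refine Continuous.subtype_mk ?_ _
  have hne (u : Set.Ici (1 : ℝ)) : (u : ℝ) ≠ 0 := (zero_lt_one.trans_le u.2).ne'
  fun_prop (disch := exact hne _)

theorem exists_graphPoint_eq {a : modifiedSineCurve} (h : a.1.1 ≠ 0) : ∃ u, graphPoint u = a := by
  have hpos : 0 < a.1.1 := (fst_nonneg a).lt_of_ne' h
  refine ⟨⟨1 / a.1.1, (one_le_div hpos).2 (fst_le_one a)⟩, Subtype.ext (Prod.ext ?_ ?_)⟩
  · exact one_div_one_div _
  · exact (snd_eq_sin h).symm

/-- The successive parameters `arcsin y + 2π, arcsin y + 4π, …` at which the graph has ordinate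
`y`. -/
noncomputable def levelParam (y : ℝ) (n : ℕ) : Set.Ici (1 : ℝ) :=
  ⟨Real.arcsin y + (n + 1 : ℕ) * (2 * Real.pi), by
    have hn : 2 * Real.pi ≤ (n + 1 : ℕ) * (2 * Real.pi) :=
      le_mul_of_one_le_left Real.two_pi_pos.le (by exact_mod_cast n.succ_pos)
    rw [Set.mem_Ici]
    linarith [Real.neg_pi_div_two_le_arcsin y, Real.pi_gt_three]⟩

theorem coe_levelParam_succ (y : ℝ) (n : ℕ) :
    (levelParam y (n + 1) : ℝ) = levelParam y n + 2 * Real.pi := by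
  simp only [levelParam]
  push_cast
  ring

theorem tendsto_levelParam (y : ℝ) : Tendsto (fun n => (levelParam y n : ℝ)) atTop atTop :=
  tendsto_atTop_add_const_left _ _ <|
    (tendsto_natCast_atTop_atTop.comp (tendsto_add_atTop_nat 1)).atTop_mul_const Real.two_pi_pos

theorem tendsto_graphPoint_levelParam {a : modifiedSineCurve} (h : a.1.1 = 0) :
    Tendsto (fun n => graphPoint (levelParam a.1.2 n)) atTop (𝓝 a) := by
  have hsin (n : ℕ) : Real.sin (levelParam a.1.2 n) = a.1.2 := by
    rw [levelParam, Real.sin_add_nat_mul_two_pi,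
      Real.sin_arcsin (snd_mem_Ico h).1 ((snd_mem_Ico h).2.le.trans zero_le_one)]
  rw [tendsto_subtype_rng, ← Prod.mk.eta (p := a.1), h]
  simp only [graphPoint, hsin]
  exact (tendsto_const_nhds.div_atTop (tendsto_levelParam _)).prodMk_nhds tendsto_const_nhds

theorem denseRange_graphPoint : DenseRange graphPoint := fun a => by
  by_cases h : a.1.1 = 0
  · exact mem_closure_of_tendsto (tendsto_graphPoint_levelParam h)
      (Eventually.of_forall fun _ => Set.mem_range_self _)
  · exact subset_closure (exists_graphPoint_eq h)

instance (a : ℝ) : PreconnectedSpace (Set.Ici a) :=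
  Subtype.preconnectedSpace isPreconnected_Ici

instance : ConnectedSpace modifiedSineCurve :=
  haveI := denseRange_graphPoint.preconnectedSpace continuous_graphPoint
  ⟨⟨rPoint⟩⟩

theorem continuous_mul_sin_one_div : Continuous fun x : ℝ => x * Real.sin (1 / x) := by
  refine continuous_iff_continuousAt.2 fun x => ?_
  rcases eq_or_ne x 0 with rfl | hx
  · rw [ContinuousAt, zero_mul]
    refine squeeze_zero_norm (fun x => ?_) (tendsto_norm_zero (E := ℝ))
    rw [norm_mul]
    exact mul_le_of_le_one_right (norm_nonneg _) (Real.abs_sin_le_one _)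
  · fun_prop (disch := assumption)

-- Multiplying `y = sin (1 / x)` by `x` makes it a closed condition that is void on the `y`-axis.
theorem isLocallyClosed : IsLocallyClosed modifiedSineCurve := by
  refine ⟨{q | 0 < q.1 ∨ q.2 < 0},
    {q | q.1 ∈ Set.Icc (0 : ℝ) 1 ∧ -1 ≤ q.2 ∧ q.1 * q.2 = q.1 * Real.sin (1 / q.1)}, ?_, ?_, ?_⟩
  · exact (isOpen_lt continuous_const continuous_fst).union
      (isOpen_lt continuous_snd continuous_const)
  · exact (isClosed_Icc.preimage continuous_fst).inter
      ((isClosed_le continuous_const continuous_snd).inter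
        (isClosed_eq (by fun_prop) (continuous_mul_sin_one_div.comp continuous_fst)))
  · ext ⟨x, y⟩
    simp only [modifiedSineCurve, Set.mem_ofPred_eq, Set.mem_inter_iff]
    constructor
    · rintro (⟨h0, h1, rfl⟩ | ⟨rfl, h1, h2⟩)
      · exact ⟨Or.inl h0, ⟨h0.le, h1⟩, Real.neg_one_le_sin _, rfl⟩
      · exact ⟨Or.inr h2, ⟨le_rfl, zero_le_one⟩, h1, by simp⟩
    · rintro ⟨h, ⟨h0, h1⟩, h2, h3⟩
      rcases h0.eq_or_lt with rfl | h0
      · exact Or.inr ⟨rfl, h2, h.resolve_left (lt_irrefl _)⟩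
      · exact Or.inl ⟨h0, h1, mul_left_cancel₀ h0.ne' h3⟩

instance : LocallyCompactSpace modifiedSineCurve := isLocallyClosed.locallyCompactSpace

end Topology

section Height

/-- The height of a point of the curve: `∞` on the limit segment, and on the graph the staircase
evaluated at the number `1 / (2πx)` of periods of the sine. -/
noncomputable def height (a : modifiedSineCurve) : ℝ≥0∞ :=
  if a.1.1 = 0 then ∞ else ENNReal.ofReal (staircase (1 / a.1.1 / (2 * Real.pi)))

theorem height_eq_top {a : modifiedSineCurve} (h : a.1.1 = 0) : height a = ∞ := if_pos h

theorem toReal_height {a : modifiedSineCurve} (h : a.1.1 ≠ 0) :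
    (height a).toReal = staircase (1 / a.1.1 / (2 * Real.pi)) := by
  have h0 := fst_nonneg a
  rw [height, if_neg h, ENNReal.toReal_ofReal]
  exact le_trans (by positivity) (le_staircase _)

theorem inv_abscissa_div_le_height (a : modifiedSineCurve) :
    (ENNReal.ofReal a.1.1)⁻¹ / ENNReal.ofReal (2 * Real.pi) ≤ height a := by
  by_cases h : a.1.1 = 0
  · rw [height_eq_top h]
    exact le_top
  · rw [← ENNReal.ofReal_inv_of_pos ((fst_nonneg a).lt_of_ne' h), ← one_div,
      ← ENNReal.ofReal_div_of_pos Real.two_pi_pos, height, if_neg h]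
    exact ENNReal.ofReal_le_ofReal (le_staircase _)

theorem continuous_height : Continuous height := by
  refine continuous_iff_continuousAt.2 fun a => ?_
  by_cases h : a.1.1 = 0
  · have hinv : Tendsto (fun b : modifiedSineCurve =>
        (ENNReal.ofReal b.1.1)⁻¹ / ENNReal.ofReal (2 * Real.pi)) (𝓝 a) (𝓝 ∞) := by
      have hc : Continuous fun b : modifiedSineCurve =>
          (ENNReal.ofReal b.1.1)⁻¹ / ENNReal.ofReal (2 * Real.pi) :=
        (ENNReal.continuous_div_const _ (by simp [Real.pi_pos])).comp
          (ENNReal.continuous_ofReal.comp continuous_abscissa).inv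
      simpa only [h, ENNReal.ofReal_zero, ENNReal.inv_zero,
        ENNReal.top_div_of_ne_top ENNReal.ofReal_ne_top] using hc.tendsto a
    rw [ContinuousAt, height_eq_top h]
    exact tendsto_nhds_top_mono' hinv inv_abscissa_div_le_height
  · have hgraph : ContinuousAt (fun b : modifiedSineCurve =>
        ENNReal.ofReal (staircase (1 / b.1.1 / (2 * Real.pi)))) a :=
      (ENNReal.continuous_ofReal.comp continuous_staircase).continuousAt.comp
        ((continuousAt_const.div continuous_abscissa.continuousAt h).div_const _)
    refine hgraph.congr ?_
    filter_upwards [continuous_abscissa.continuousAt.eventually_ne h] with b hb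
    rw [height, if_neg hb]

theorem coe_toReal_height_eq_zero {a : modifiedSineCurve} (h : a.1.2 < 0) :
    ((height a).toReal : UnitAddCircle) = 0 := by
  by_cases h0 : a.1.1 = 0
  · simp [height_eq_top h0]
  · have hsin : Real.sin (1 / a.1.1 / (2 * Real.pi) * (2 * Real.pi)) < 0 := by
      rwa [div_mul_cancel₀ _ Real.two_pi_pos.ne', ← snd_eq_sin h0]
    rw [toReal_height h0, staircase_eq_round (le_round_of_sin_neg hsin)]
    exact (AddCircle.coe_eq_zero_iff 1).2 ⟨_, zsmul_one _⟩

theorem isHeight_height : AlexanderSpanier.IsHeight height where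
  continuous := continuous_height
  eventually_coe_eq_zero a ha := by
    have h0 : a.1.1 = 0 := by
      by_contra h0
      exact ENNReal.ofReal_ne_top ((if_neg h0).symm.trans ha)
    have hneg : ∀ᶠ b : modifiedSineCurve in 𝓝 a, b.1.2 < 0 :=
      (continuous_snd.comp continuous_subtype_val).continuousAt.eventually_lt_const
        (snd_mem_Ico h0).2
    exact hneg.mono fun _ => coe_toReal_height_eq_zero

theorem height_sPoint_le (a : modifiedSineCurve) : height sPoint ≤ height a := by
  by_cases h : a.1.1 = 0
  · rw [height_eq_top h]
    exact le_top
  · have hs : (sPoint : modifiedSineCurve).1.1 = 1 := rfl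
    rw [height, height, if_neg h, if_neg (hs ▸ one_ne_zero), hs]
    have hpos : 0 < a.1.1 := (fst_nonneg a).lt_of_ne' h
    have ha := fst_le_one a
    exact ENNReal.ofReal_le_ofReal (monotone_staircase (by gcongr))

theorem toReal_height_graphPoint (u : Set.Ici (1 : ℝ)) :
    (height (graphPoint u)).toReal = staircase (u / (2 * Real.pi)) := by
  have hu : (0 : ℝ) < u := zero_lt_one.trans_le u.2
  rw [toReal_height (one_div_pos.2 hu).ne']
  simp only [graphPoint, one_div_one_div]

theorem toReal_height_graphPoint_levelParam_succ (y : ℝ) (n : ℕ) :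
    (height (graphPoint (levelParam y (n + 1)))).toReal =
      (height (graphPoint (levelParam y n))).toReal + 1 := by
  rw [toReal_height_graphPoint, toReal_height_graphPoint, coe_levelParam_succ, add_div,
    div_self Real.two_pi_pos.ne', staircase_add_one]

end Height

open AlexanderSpanier

variable {G : Type*} [AddCommGroup G]

theorem windingClass_height_ne_zero {g : G} (hg : g ≠ 0) :
    windingClass g (fun a => (height a).toReal) isHeight_height.continuous_coe_toReal ≠ 0 := by
  have hcont : Continuous fun u => (height (graphPoint u)).toReal := by
    simp only [toReal_height_graphPoint]
    exact continuous_staircase.comp (continuous_subtype_val.div_const _)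
  refine windingClass_ne_zero_of_returns _ continuous_graphPoint hcont (a := rPoint) fun U hU => ?_
  obtain ⟨n, hn⟩ := ((tendsto_graphPoint_levelParam rfl).eventually hU).exists_forall_of_atTop
  refine ⟨_, _, hn n le_rfl, hn (n + 1) n.le_succ, ?_⟩
  simpa only [toReal_height_graphPoint_levelParam_succ, add_sub_cancel_left, round_one,
    one_smul] using hg

theorem map_sliceEmbedding_rPoint_ne_sPoint [Nontrivial G] :
    H.map G (sliceEmbedding modifiedSineCurve rPoint) 1 ≠
      H.map G (sliceEmbedding modifiedSineCurve sPoint) 1 := by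
  obtain ⟨g, hg⟩ := exists_ne (0 : G)
  exact isHeight_height.map_sliceEmbedding_ne isHeight_height (windingClass_height_ne_zero hg)
    (height_eq_top rfl) height_sPoint_le

end modifiedSineCurve

theorem theorem2_general (G : Type*) [AddCommGroup G] [Nontrivial G] :
    (∃ (X T : Type) (_ : TopologicalSpace X) (_ : TopologicalSpace T) (r s : T),
      T2Space X ∧ LocallyCompactSpace X ∧ ConnectedSpace X ∧
      T2Space T ∧ LocallyCompactSpace T ∧ ConnectedSpace T ∧
      ∃ n : ℕ, AlexanderSpanier.H.map G (sliceEmbedding X r) n ≠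
        AlexanderSpanier.H.map G (sliceEmbedding X s) n) ∧
    (LocallyCompactSpace modifiedSineCurve ∧ ConnectedSpace modifiedSineCurve ∧
      AlexanderSpanier.H.map G (sliceEmbedding modifiedSineCurve rPoint) 1 ≠
        AlexanderSpanier.H.map G (sliceEmbedding modifiedSineCurve sPoint) 1) := by
  have hne := modifiedSineCurve.map_sliceEmbedding_rPoint_ne_sPoint (G := G)
  exact ⟨⟨modifiedSineCurve, modifiedSineCurve, inferInstance, inferInstance, rPoint, sPoint,
    inferInstance, inferInstance, inferInstance, inferInstance, inferInstance, inferInstance,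
    1, hne⟩, inferInstance, inferInstance, hne⟩

theorem theorem2 (p : ℕ) [Fact p.Prime] :
    -- existence of locally compact (Hausdorff) connected spaces and two points
    (∃ (X T : Type) (_ : TopologicalSpace X) (_ : TopologicalSpace T) (r s : T),
      T2Space X ∧ LocallyCompactSpace X ∧ ConnectedSpace X ∧
      T2Space T ∧ LocallyCompactSpace T ∧ ConnectedSpace T ∧
      ∃ n : ℕ, AlexanderSpanier.H.map (ZMod p) (sliceEmbedding X r) n ≠
        AlexanderSpanier.H.map (ZMod p) (sliceEmbedding X s) n) ∧
    -- the explicit example `X = T`, the modified topologist's sine curve, in degree one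
    (LocallyCompactSpace modifiedSineCurve ∧ ConnectedSpace modifiedSineCurve ∧
      AlexanderSpanier.H.map (ZMod p) (sliceEmbedding modifiedSineCurve rPoint) 1 ≠
        AlexanderSpanier.H.map (ZMod p) (sliceEmbedding modifiedSineCurve sPoint) 1) :=
  theorem2_general (ZMod p)
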